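/- All vector spaces and Lie algebras are finite-dimensional over $\mathbb R$; $\mathcal Z(\cdot)$ denotes the center of a Lie algebra. Let $\mathfrak g$ be a Lie algebra with $1$-dimensional center $\mathfrak z=\mathcal Z(\mathfrak g)$, and assume that $\mathfrak g=\mathfrak k\,\tilde\rtimes\,\mathfrak a$ is the reduced semidirect product of two subalgebras $\mathfrak k,\mathfrak a$, that is, $[\mathfrak a,\mathfrak k]\subseteq\mathfrak k$, $\mathfrak g=\mathfrak k+\mathfrak a$ and $\mathfrak k\cap\mathfrak a=\mathfrak z$. Assume that $\mathfrak k$ is nilpotent with $1$-dimensional center and has a grading of type $(A_+)$, that is, a triple $\gamma=(\mathfrak z,\mathfrak c,\mathcal V)$ of linear subspaces with $\mathfrak k=\mathfrak z\oplus\mathfrak c\oplus\mathcal V$ (direct sum of vector spaces), $\mathfrak z=\mathcal Z(\mathfrak k)$, $[\mathfrak c,\mathfrak c]=0$, $[\mathcal V,\mathcal V]\subseteq\mathfrak c$, such that the bracket restricts to a duality pairing (nondegenerate bilinear map) $\mathfrak c\times\mathcal V\to\mathfrak z\simeq\mathbb R$. Assume that $\mathfrak a$ is a nilpotent Lie algebra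 with $[\mathfrak a,\mathfrak a]\subseteq\mathfrak z$ and that $\mathfrak a$ is compatible with $\gamma$, that is, $[\mathfrak a,\mathcal V]\subseteq\mathfrak c$ and $[\mathfrak a,\mathfrak z+\mathfrak c]=0$. Let $G$ be the connected, simply connected Lie group with Lie algebra $\mathfrak g$. A coadjoint orbit of $G$ in $\mathfrak g^*$ is called generic if it has maximal dimension among all coadjoint orbits, and flat if it is an affine subspace of $\mathfrak g^*$. A Heisenberg algebra is a Lie algebra having, for some $n\ge 1$, a basis $Z,Y_1,\dots,Y_n,X_1,\dots,X_n$ whose only nonzero brackets of basis elements are $[X_i,Y_i]=Z=-[Y_i,X_i]$. A polarization at $\xi\in\mathfrak g^*$ is a subalgebra of $\mathfrak g$ that is maximal among the linear subspaces $W\subseteq\mathfrak g$ with $\langle\xi,[W,W]\rangle=0$. Then: 1. All generic coadjoint orbits of $G$ are flat if and only if either $\mathfrak a=\mathfrak z$ or $\mathfrak a$ is a Heisenberg algebra. 2. If this is the case, then there is an ideal of $\mathfrak g$ that is maximal among the abelian ideals of $\mathfrak g$ and that is a polarization at every point of every generic coadjoint orbit. -/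

import Mathlib

open Module

noncomputable section

namespace KirillovLemma

/-! ### Gradings, reduced semidirect products, Heisenberg algebras -/

/-- A grading of type `(A₊)` of a Lie algebra `k`, that is, a triple `(z, c, V)` of linear subspaces
with `k = z ∔ c ∔ V`, where `k` is nilpotent with one-dimensional center, `z` is the center of `k`,
`[c, c] = 0`, `[V, V] ⊆ c`, and the bracket restricts to a duality pairing
`c × V → center` (takes values in the one-dimensional center, and is nondegenerate on both sides). -/
structure IsGradingOfTypeAPlus (K : Type*) {k : Type*} [Field K] [LieRing k] [LieAlgebra K k]
    (z c V : Submodule K k) : Prop where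
  nilpotent : LieRing.IsNilpotent k
  finrank_center : finrank K (LieAlgebra.center K k) = 1
  isInternal : DirectSum.IsInternal ![z, c, V]
  eq_center : z = (LieAlgebra.center K k).toSubmodule
  lie_c_c : ∀ x ∈ c, ∀ y ∈ c, ⁅x, y⁆ = 0
  lie_V_V : ∀ v ∈ V, ∀ w ∈ V, ⁅v, w⁆ ∈ c
  lie_c_V : ∀ x ∈ c, ∀ v ∈ V, ⁅x, v⁆ ∈ LieAlgebra.center K k
  nondegenerate_left : ∀ x ∈ c, (∀ v ∈ V, ⁅x, v⁆ = 0) → x = 0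
  nondegenerate_right : ∀ v ∈ V, (∀ x ∈ c, ⁅x, v⁆ = 0) → v = 0

/-- `g` is the reduced semidirect product of its Lie subalgebras `g₁` and `g₂`. -/
structure IsReducedSemidirectProduct {K g : Type*} [Field K] [LieRing g] [LieAlgebra K g]
    (g₁ g₂ : LieSubalgebra K g) : Prop where
  finrank_center : finrank K (LieAlgebra.center K g) = 1
  lie_mem : ∀ x ∈ g₂, ∀ y ∈ g₁, ⁅x, y⁆ ∈ g₁
  sup_eq_top : g₁.toSubmodule ⊔ g₂.toSubmodule = ⊤
  center_eq_inf : (LieAlgebra.center K g).toSubmodule = g₁.toSubmodule ⊓ g₂.toSubmodule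

/-- The subalgebra `a` (with `[a, k] ⊆ k`) is compatible with the grading `(z, c, V)` of the
subalgebra `k`: `[a, V] ⊆ c` and `[a, z + c] = 0`. -/
structure IsCompatibleWithGrading {K g : Type*} [Field K] [LieRing g] [LieAlgebra K g]
    (a k : LieSubalgebra K g) (z c V : Submodule K k) : Prop where
  lie_mem : ∀ x ∈ a, ∀ y ∈ k, ⁅x, y⁆ ∈ k
  lie_V : ∀ x ∈ a, ∀ v ∈ V, ∃ y ∈ c, ⁅x, (v : g)⁆ = (y : g)
  lie_z_sup_c : ∀ x ∈ a, ∀ y ∈ z ⊔ c, ⁅x, (y : g)⁆ = 0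

/-- A Heisenberg algebra: for some `n ≥ 1` it has a basis `Z, Y₁, …, Yₙ, X₁, …, Xₙ` for which
`[Xᵢ, Yⱼ] = δᵢⱼ Z`, while `Z` is central and `[Xᵢ, Xⱼ] = [Yᵢ, Yⱼ] = 0`. -/
def IsHeisenbergAlgebra (K : Type*) (h : Type*) [Field K] [LieRing h] [LieAlgebra K h] : Prop :=
  ∃ n : ℕ, 1 ≤ n ∧ ∃ (Z : h) (Y X : Fin n → h) (b : Basis (Unit ⊕ Fin n ⊕ Fin n) K h),
    (⇑b = Sum.elim (fun _ => Z) (Sum.elim Y X)) ∧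
    (∀ x : h, ⁅Z, x⁆ = 0) ∧
    (∀ i j, ⁅X i, X j⁆ = 0) ∧
    (∀ i j, ⁅Y i, Y j⁆ = 0) ∧
    (∀ i j, ⁅X i, Y j⁆ = if i = j then Z else 0)

/-! ### Coadjoint orbits

Below `g` is a finite-dimensional real Lie algebra. A connected Lie group `G` with Lie algebra `g`
is generated by the elements `exp X`, `X ∈ g`, and `Ad (exp X) = e^{ad X}`. So `Ad(G)` is the group
of linear automorphisms of `g` generated by the operators `e^{ad X}`, and `x ∈ G` acts on the
dual space of `g` by `ξ ↦ ξ ∘ Ad(x)⁻¹`. -/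

/-- `φ = e^{ad X}`, the sum of the exponential series (as `g` is finite-dimensional, convergence of
the series means convergence after evaluating at any vector and any linear functional). -/
def IsExpAd {g : Type*} [LieRing g] [LieAlgebra ℝ g] (X : g) (φ : g ≃ₗ[ℝ] g) : Prop :=
  ∀ (x : g) (η : Dual ℝ g),
    HasSum (fun n : ℕ => ((Nat.factorial n : ℕ) : ℝ)⁻¹ * η ((LieAlgebra.ad ℝ g X ^ n) x)) (η (φ x))

/-- The adjoint group `Ad(G)` of a connected Lie group `G` with Lie algebra `g`. -/
def adjointGroup (g : Type*) [LieRing g] [LieAlgebra ℝ g] : Subgroup (g ≃ₗ[ℝ] g) :=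
  Subgroup.closure {φ | ∃ X : g, IsExpAd X φ}

/-- The coadjoint orbit of `ξ`. -/
def coadjointOrbit {g : Type*} [LieRing g] [LieAlgebra ℝ g] (ξ : Dual ℝ g) : Set (Dual ℝ g) :=
  {η | ∃ φ ∈ adjointGroup g, η = ξ ∘ₗ ((φ⁻¹ : g ≃ₗ[ℝ] g) : g →ₗ[ℝ] g)}

/-- The tangent space at `ξ` of the coadjoint orbit of `ξ`: all functionals
`X · ξ = (Y ↦ -ξ([X, Y]))` with `X ∈ g`. -/
def coadjointOrbitTangent {g : Type*} [LieRing g] [LieAlgebra ℝ g] (ξ : Dual ℝ g) :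
    Submodule ℝ (Dual ℝ g) :=
  LinearMap.range ((LieModule.toEnd ℝ g (Dual ℝ g) : g →ₗ[ℝ] End ℝ (Dual ℝ g)).flip ξ)

/-- The generic coadjoint orbits: those of maximal dimension. -/
def IsGenericCoadjointOrbit {g : Type*} [LieRing g] [LieAlgebra ℝ g] (O : Set (Dual ℝ g)) : Prop :=
  ∃ ξ : Dual ℝ g, O = coadjointOrbit ξ ∧
    ∀ η : Dual ℝ g, finrank ℝ (coadjointOrbitTangent η) ≤ finrank ℝ (coadjointOrbitTangent ξ)

/-- A subset of a vector space is flat if it is an affine subspace. -/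
def IsFlat {E : Type*} [AddCommGroup E] [Module ℝ E] (O : Set E) : Prop :=
  ∃ A : AffineSubspace ℝ E, (A : Set E) = O

/-- The connected Lie group with Lie algebra `g` has flat generic coadjoint orbits. -/
def HasFlatGenericCoadjointOrbits (g : Type*) [LieRing g] [LieAlgebra ℝ g] : Prop :=
  ∀ O : Set (Dual ℝ g), IsGenericCoadjointOrbit O → IsFlat O

/-- The Lie subalgebra `p` is a polarization at `ξ`: it is maximal among the linear subspaces that
are isotropic for the bilinear form `(x, y) ↦ ξ([x, y])`. -/
def IsPolarization {g : Type*} [LieRing g] [LieAlgebra ℝ g] (p : LieSubalgebra ℝ g)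
    (ξ : Dual ℝ g) : Prop :=
  Maximal (fun W : Submodule ℝ g => ∀ x ∈ W, ∀ y ∈ W, ξ ⁅x, y⁆ = 0) p.toSubmodule

end KirillovLemma

end

/-!
The subalgebra `k` has a center that is a line containing `𝒵(g) = ℝ Z`, so inside `g` one has
`g = C + V + A`, where `A` is the subspace `a` and `k = ℝ Z + C + V`
(`IsAdaptedDecomposition`). The only nonzero brackets are `[V, V], [A, V] ⊆ C`,
`[C, V] ⊆ ℝ Z` (a duality) and `[A, A] ⊆ ℝ Z`. In particular `g` is three-step nilpotent and the
operators `e^{ad X}` are quadratic polynomials in `ad X`. Everything depends on the center `R` of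
`A`: `A` is `ℝ Z` or a Heisenberg algebra exactly if `R = ℝ Z` (`isHeisenbergAlgebra`,
`mem_span_of_isHeisenbergAlgebra`).

Every `ξ` with `ξ(Z) ≠ 0` has an orbit of maximal dimension (`finrank_tangent_le`).

* If `R = ℝ Z` and `ξ(Z) ≠ 0`, the orbit of `ξ` is the whole hyperplane `{η | η(Z) = ξ(Z)}`: the
  values of a functional on `C`, `A` and `V` can be adjusted one after the other
  (`mem_coadjointOrbit`). A functional of maximal orbit dimension that vanishes on `Z` exists only
  if `g` is abelian (`apply_ne_zero_or_lie_eq_zero`), and then orbits are points.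
* Conversely, for `b ∈ R` the adjoint group acts on `C` and `b` only through `e^{ad v}` with
  `v ∈ V`. So for a point `ξ ∘ e^{ad v}` of the orbit the restriction to `C` is affine in `v` and
  determines `v`, while the value at `b` has the quadratic part `ξ([v, [v, b]]) / 2`. If the orbit is
  flat, this part vanishes; as `(v, w) ↦ [v, [w, b]]` is symmetric and `C × V → ℝ Z` is
  nondegenerate, `[V, b] = 0` and `b` is central in `g` (`mem_span_of_isFlat`).

The ideal of the second assertion is `C + L`, where `L` is a maximal abelian subspace of `A`
(`exists_ideal_isPolarization`).
-/

namespace KirillovLemma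

/-! ### Exponentials of nilpotent derivations -/

section Exponential

variable {g : Type*} [LieRing g] [LieAlgebra ℝ g]

/-- The operator `e^{ad X}`, given by the polynomial `1 + ad X + (ad X)² / 2`, for `(ad X)³ = 0`. -/
noncomputable def expAd (X : g) (h : ∀ x : g, ⁅X, ⁅X, ⁅X, x⁆⁆⁆ = 0) : g ≃ₗ[ℝ] g :=
  LinearEquiv.ofLinearMap
    (LinearMap.id + LieAlgebra.ad ℝ g X
      + (2⁻¹ : ℝ) • (LieAlgebra.ad ℝ g X ∘ₗ LieAlgebra.ad ℝ g X))
    (LinearMap.id - LieAlgebra.ad ℝ g X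
      + (2⁻¹ : ℝ) • (LieAlgebra.ad ℝ g X ∘ₗ LieAlgebra.ad ℝ g X))
    (by ext x; simp [h]; module)
    (by ext x; simp [h]; module)

theorem expAd_apply (X : g) (h : ∀ x : g, ⁅X, ⁅X, ⁅X, x⁆⁆⁆ = 0) (x : g) :
    expAd X h x = x + ⁅X, x⁆ + (2⁻¹ : ℝ) • ⁅X, ⁅X, x⁆⁆ := by
  simp [expAd]

theorem isExpAd_expAd (X : g) (h : ∀ x : g, ⁅X, ⁅X, ⁅X, x⁆⁆⁆ = 0) : IsExpAd X (expAd X h) := by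
  intro x η
  have key : ∀ n ∉ Finset.range 3,
      ((Nat.factorial n : ℕ) : ℝ)⁻¹ * η ((LieAlgebra.ad ℝ g X ^ n) x) = 0 := by
    intro n hn
    obtain ⟨m, rfl⟩ : ∃ m, n = m + 3 := ⟨n - 3, by simp at hn; omega⟩
    have h3 : (LieAlgebra.ad ℝ g X ^ 3) x = 0 := by simp [pow_succ, h]
    rw [pow_add, Module.End.mul_apply, h3]
    simp
  have := hasSum_sum_of_ne_finset_zero (L := .unconditional ℕ) key
  rw [expAd_apply]
  convert this using 1
  simp [Finset.sum_range_succ, pow_succ, Nat.factorial]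

theorem IsExpAd.apply_eq {X : g} {φ : g ≃ₗ[ℝ] g} (hφ : IsExpAd X φ)
    (h : ∀ x : g, ⁅X, ⁅X, ⁅X, x⁆⁆⁆ = 0) (x : g) :
    φ x = x + ⁅X, x⁆ + (2⁻¹ : ℝ) • ⁅X, ⁅X, x⁆⁆ := by
  rw [← expAd_apply X h, ← sub_eq_zero, ← Module.forall_dual_apply_eq_zero_iff ℝ]
  intro η
  rw [map_sub, sub_eq_zero]
  exact (hφ x η).unique (isExpAd_expAd X h x η)

theorem expAd_mem_adjointGroup (X : g) (h : ∀ x : g, ⁅X, ⁅X, ⁅X, x⁆⁆⁆ = 0) :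
    expAd X h ∈ adjointGroup g :=
  Subgroup.subset_closure ⟨X, isExpAd_expAd X h⟩

theorem mem_coadjointOrbit_iff {ξ η : Dual ℝ g} :
    η ∈ coadjointOrbit ξ ↔ ∃ φ ∈ adjointGroup g, ∀ x, η x = ξ (φ x) := by
  constructor
  · rintro ⟨φ, hφ, rfl⟩
    exact ⟨φ⁻¹, inv_mem hφ, fun x => rfl⟩
  · rintro ⟨φ, hφ, h⟩
    refine ⟨φ⁻¹, inv_mem hφ, ?_⟩
    ext x
    simp [h]

/-- The stabilizer algebra `g(ξ)` is the kernel of the infinitesimal coadjoint action at `ξ`. -/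
theorem mem_ker_toEnd_flip {ξ : Dual ℝ g} {x : g} :
    x ∈ LinearMap.ker ((LieModule.toEnd ℝ g (Dual ℝ g) : g →ₗ[ℝ] End ℝ (Dual ℝ g)).flip ξ) ↔
      ∀ y, ξ ⁅x, y⁆ = 0 := by
  rw [LinearMap.mem_ker, LinearMap.ext_iff]
  simp

end Exponential

/-! ### Pairings given by a functional and the bracket -/

section Pairing

variable {g : Type*} [LieRing g] [LieAlgebra ℝ g]

/-- The linear map `P → Q*`, `x ↦ ξ([x, ·])`, for linear subspaces `P` and `Q`. -/
noncomputable def bracketPairing (ξ : Dual ℝ g) (P Q : Submodule ℝ g) : P →ₗ[ℝ] Dual ℝ Q :=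
  LinearMap.mk₂ ℝ (fun x y => ξ ⁅(x : g), (y : g)⁆) (by simp) (by simp) (by simp) (by simp)

@[simp]
theorem bracketPairing_apply (ξ : Dual ℝ g) (P Q : Submodule ℝ g) (x : P) (y : Q) :
    bracketPairing ξ P Q x y = ξ ⁅(x : g), (y : g)⁆ := rfl

/-- A functional that vanishes on the right kernel of the pairing `ξ([·, ·])` on `P × Q` is
represented on `Q` by an element of `P`. -/
theorem exists_forall_apply_lie_eq [FiniteDimensional ℝ g] (ξ f : Dual ℝ g) (P Q : Submodule ℝ g)
    (hf : ∀ y ∈ Q, (∀ x ∈ P, ξ ⁅x, y⁆ = 0) → f y = 0) :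
    ∃ x ∈ P, ∀ y ∈ Q, ξ ⁅x, y⁆ = f y := by
  have : f ∘ₗ Q.subtype ∈ LinearMap.range (bracketPairing ξ P Q) := by
    rw [← Subspace.dualCoannihilator_dualAnnihilator_eq
      (W := LinearMap.range (bracketPairing ξ P Q)), Submodule.mem_dualAnnihilator]
    intro y hy
    rw [Submodule.mem_dualCoannihilator] at hy
    exact hf y y.2 fun x hx => hy _ ⟨⟨x, hx⟩, rfl⟩
  obtain ⟨x, hx⟩ := this
  exact ⟨x, x.2, fun y hy => by simpa using LinearMap.congr_fun hx ⟨y, hy⟩⟩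

end Pairing

/-! ### Decompositions adapted to the reduced semidirect product -/

/-- The structure of `g = k ⋊̃ a` seen inside `g`: the center is spanned by `Z`, and
`g = C + V + A`, where `k = ℝ Z + C + V` is graded of type `(A₊)` and `A` is the subspace `a`.
The sums are not required to be direct, as this follows from the other conditions. -/
structure IsAdaptedDecomposition {g : Type*} [LieRing g] [LieAlgebra ℝ g]
    (Z : g) (C V A : Submodule ℝ g) : Prop where
  center_eq : (LieAlgebra.center ℝ g).toSubmodule = Submodule.span ℝ {Z}
  ne_zero : Z ≠ 0
  mem_A : Z ∈ A
  exists_add : ∀ x, ∃ y ∈ C, ∃ v ∈ V, ∃ b ∈ A, x = y + v + b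
  lie_C_C : ∀ x ∈ C, ∀ y ∈ C, ⁅x, y⁆ = 0
  lie_V_V : ∀ x ∈ V, ∀ y ∈ V, ⁅x, y⁆ ∈ C
  lie_C_V : ∀ x ∈ C, ∀ y ∈ V, ⁅x, y⁆ ∈ Submodule.span ℝ {Z}
  nondegenerate_left : ∀ x ∈ C, (∀ v ∈ V, ⁅x, v⁆ = 0) → x = 0
  nondegenerate_right : ∀ v ∈ V, (∀ x ∈ C, ⁅x, v⁆ = 0) → v = 0
  lie_A_C : ∀ x ∈ A, ∀ y ∈ C, ⁅x, y⁆ = 0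
  lie_A_V : ∀ x ∈ A, ∀ y ∈ V, ⁅x, y⁆ ∈ C
  lie_A_A : ∀ x ∈ A, ∀ y ∈ A, ⁅x, y⁆ ∈ Submodule.span ℝ {Z}

theorem exists_isAdaptedDecomposition {g : Type*} [LieRing g] [LieAlgebra ℝ g]
    {k a : LieSubalgebra ℝ g} {z c V : Submodule ℝ k}
    (hg : IsReducedSemidirectProduct k a)
    (hγ : IsGradingOfTypeAPlus ℝ z c V)
    (ha_lie : ∀ x ∈ a, ∀ y ∈ a, ⁅x, y⁆ ∈ LieAlgebra.center ℝ g)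
    (ha_comp : IsCompatibleWithGrading a k z c V) :
    ∃ Z : g, IsAdaptedDecomposition Z (c.map k.toSubmodule.subtype) (V.map k.toSubmodule.subtype)
      a.toSubmodule := by
  obtain ⟨⟨Z, hZ⟩, hZ0, hZs⟩ := finrank_eq_one_iff'.1 hg.finrank_center
  have hZ0' : Z ≠ 0 := fun h => hZ0 (by ext; exact h)
  have hcen : (LieAlgebra.center ℝ g).toSubmodule = Submodule.span ℝ {Z} := by
    apply le_antisymm
    · intro x hx
      obtain ⟨r, hr⟩ := hZs ⟨x, hx⟩
      exact Submodule.mem_span_singleton.2 ⟨r, congrArg Subtype.val hr⟩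
    · rw [Submodule.span_singleton_le_iff_mem]
      exact hZ
  have hZka : Z ∈ k.toSubmodule ⊓ a.toSubmodule := by
    rw [← hg.center_eq_inf]; exact hZ
  have hZc : ∀ x : g, ⁅x, Z⁆ = 0 := (LieModule.mem_maxTrivSubmodule ℝ g g Z).1 hZ
  have hZk : (⟨Z, hZka.1⟩ : k) ∈ LieAlgebra.center ℝ k :=
    (LieModule.mem_maxTrivSubmodule ℝ k k _).2 fun x => by ext; exact hZc x
  -- The center of `k` is a line that contains `Z`.
  have hk : ∀ w : k, w ∈ LieAlgebra.center ℝ k → (w : g) ∈ Submodule.span ℝ {Z} := by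
    intro w hw
    obtain ⟨r, hr⟩ := (finrank_eq_one_iff_of_nonzero'
      (⟨_, hZk⟩ : LieAlgebra.center ℝ k)
      (fun h => hZ0' (congrArg (fun u : LieAlgebra.center ℝ k => ((u : k) : g)) h))).1
      hγ.finrank_center ⟨w, hw⟩
    exact Submodule.mem_span_singleton.2
      ⟨r, congrArg (fun u : LieAlgebra.center ℝ k => ((u : k) : g)) hr⟩
  refine ⟨Z, hcen, hZ0', hZka.2, ?_, ?_, ?_, ?_, ?_, ?_, ?_, ?_, ?_⟩
  · intro x
    have hx : x ∈ k.toSubmodule ⊔ a.toSubmodule := by rw [hg.sup_eq_top]; trivial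
    obtain ⟨w, hw, b, hb, rfl⟩ := Submodule.mem_sup.1 hx
    have h3 : (⟨w, hw⟩ : k) ∈ z ⊔ c ⊔ V := by
      have := hγ.isInternal.submodule_iSup_eq_top
      have h4 : iSup ![z, c, V] ≤ z ⊔ c ⊔ V := by
        refine iSup_le fun i => ?_
        fin_cases i
        · exact le_sup_left.trans le_sup_left
        · exact le_sup_right.trans le_sup_left
        · exact le_sup_right
      exact h4 (by rw [this]; trivial)
    obtain ⟨u, hu, v, hv, huv⟩ := Submodule.mem_sup.1 h3
    obtain ⟨s, hs, y, hy, rfl⟩ := Submodule.mem_sup.1 hu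
    have hs' : (s : g) ∈ a.toSubmodule := by
      rw [hγ.eq_center] at hs
      exact (Submodule.span_singleton_le_iff_mem Z _).2 hZka.2 (hk s hs)
    refine ⟨y, ⟨y, hy, rfl⟩, v, ⟨v, hv, rfl⟩, s + b, add_mem hs' hb, ?_⟩
    have : (s : g) + y + v = w := congrArg Subtype.val huv
    rw [← this]; abel
  · rintro _ ⟨x, hx, rfl⟩ _ ⟨y, hy, rfl⟩
    exact congrArg Subtype.val (hγ.lie_c_c x hx y hy)
  · rintro _ ⟨x, hx, rfl⟩ _ ⟨y, hy, rfl⟩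
    exact ⟨_, hγ.lie_V_V x hx y hy, rfl⟩
  · rintro _ ⟨x, hx, rfl⟩ _ ⟨y, hy, rfl⟩
    exact hk _ (hγ.lie_c_V x hx y hy)
  · rintro _ ⟨x, hx, rfl⟩ h
    rw [hγ.nondegenerate_left x hx fun v hv => Subtype.ext (h v ⟨v, hv, rfl⟩), map_zero]
  · rintro _ ⟨v, hv, rfl⟩ h
    rw [hγ.nondegenerate_right v hv fun x hx => Subtype.ext (h x ⟨x, hx, rfl⟩), map_zero]
  · rintro x hx _ ⟨y, hy, rfl⟩
    exact ha_comp.lie_z_sup_c x hx y (Submodule.mem_sup_right hy)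
  · rintro x hx _ ⟨v, hv, rfl⟩
    obtain ⟨y, hy, h⟩ := ha_comp.lie_V x hx v hv
    exact ⟨y, hy, h.symm⟩
  · intro x hx y hy
    rw [← hcen]
    exact ha_lie x hx y hy

namespace IsAdaptedDecomposition

variable {g : Type*} [LieRing g] [LieAlgebra ℝ g]
  {Z : g} {C V A : Submodule ℝ g}

theorem mem_center_iff (H : IsAdaptedDecomposition Z C V A) {x : g} :
    x ∈ Submodule.span ℝ {Z} ↔ ∀ y : g, ⁅y, x⁆ = 0 := by
  rw [← H.center_eq]
  exact LieModule.mem_maxTrivSubmodule ℝ g g x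

theorem lie_Z (H : IsAdaptedDecomposition Z C V A) (x : g) : ⁅x, Z⁆ = 0 :=
  H.mem_center_iff.1 (Submodule.mem_span_singleton_self Z) x

theorem Z_lie (H : IsAdaptedDecomposition Z C V A) (x : g) : ⁅Z, x⁆ = 0 := by
  rw [← lie_skew, H.lie_Z, neg_zero]

theorem span_le (H : IsAdaptedDecomposition Z C V A) : Submodule.span ℝ {Z} ≤ A :=
  (Submodule.span_singleton_le_iff_mem Z A).2 H.mem_A

theorem lie_C_A (H : IsAdaptedDecomposition Z C V A) {y b : g} (hy : y ∈ C) (hb : b ∈ A) :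
    ⁅y, b⁆ = 0 := by
  rw [← lie_skew, H.lie_A_C b hb y hy, neg_zero]

theorem lie_V_C (H : IsAdaptedDecomposition Z C V A) {v y : g} (hv : v ∈ V) (hy : y ∈ C) :
    ⁅v, y⁆ ∈ Submodule.span ℝ {Z} := by
  rw [← lie_skew]; exact neg_mem (H.lie_C_V y hy v hv)

theorem lie_V_A (H : IsAdaptedDecomposition Z C V A) {v b : g} (hv : v ∈ V) (hb : b ∈ A) :
    ⁅v, b⁆ ∈ C := by
  rw [← lie_skew]; exact neg_mem (H.lie_A_V b hb v hv)

theorem lie_mem_sup (H : IsAdaptedDecomposition Z C V A) (x y : g) :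
    ⁅x, y⁆ ∈ Submodule.span ℝ {Z} ⊔ C := by
  obtain ⟨y₁, hy₁, v₁, hv₁, b₁, hb₁, rfl⟩ := H.exists_add x
  obtain ⟨y₂, hy₂, v₂, hv₂, b₂, hb₂, rfl⟩ := H.exists_add y
  have h1 : Submodule.span ℝ {Z} ≤ Submodule.span ℝ {Z} ⊔ C := le_sup_left
  have h2 : C ≤ Submodule.span ℝ {Z} ⊔ C := le_sup_right
  simp only [add_lie, lie_add, H.lie_C_C _ hy₁ _ hy₂, H.lie_C_A hy₁ hb₂, H.lie_A_C _ hb₁ _ hy₂]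
  have e1 := h1 (H.lie_C_V _ hy₁ _ hv₂)
  have e2 := h1 (H.lie_V_C hv₁ hy₂)
  have e3 := h2 (H.lie_V_V _ hv₁ _ hv₂)
  have e4 := h2 (H.lie_V_A hv₁ hb₂)
  have e5 := h2 (H.lie_A_V _ hb₁ _ hv₂)
  have e6 := h1 (H.lie_A_A _ hb₁ _ hb₂)
  have e0 := zero_mem (Submodule.span ℝ {Z} ⊔ C)
  repeat' apply add_mem
  all_goals assumption

theorem lie_C_mem (H : IsAdaptedDecomposition Z C V A) (x : g) {y : g} (hy : y ∈ C) :
    ⁅x, y⁆ ∈ Submodule.span ℝ {Z} := by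
  obtain ⟨y₁, hy₁, v₁, hv₁, b₁, hb₁, rfl⟩ := H.exists_add x
  rw [add_lie, add_lie, H.lie_C_C _ hy₁ _ hy, H.lie_A_C _ hb₁ _ hy, zero_add, add_zero]
  exact H.lie_V_C hv₁ hy

theorem lie_sup_mem (H : IsAdaptedDecomposition Z C V A) (x : g) {y : g}
    (hy : y ∈ Submodule.span ℝ {Z} ⊔ C) : ⁅x, y⁆ ∈ Submodule.span ℝ {Z} := by
  obtain ⟨s, hs, w, hw, rfl⟩ := Submodule.mem_sup.1 hy
  rw [lie_add, H.mem_center_iff.1 hs, zero_add]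
  exact H.lie_C_mem x hw

/-- The Lie algebra is three-step nilpotent. -/
theorem lie_lie_lie (H : IsAdaptedDecomposition Z C V A) (w x y u : g) : ⁅w, ⁅x, ⁅y, u⁆⁆⁆ = 0 :=
  H.mem_center_iff.1 (H.lie_sup_mem x (H.lie_mem_sup y u)) w

theorem eq_zero_of_mem_span {ξ : Dual ℝ g} (hξ : ξ Z ≠ 0) {x : g}
    (hx : x ∈ Submodule.span ℝ {Z}) (h : ξ x = 0) : x = 0 := by
  obtain ⟨r, rfl⟩ := Submodule.mem_span_singleton.1 hx
  have : r = 0 := by simpa [hξ] using h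
  simp [this]

theorem eq_smul_of_mem_span {τ : Dual ℝ g} (hτ : τ Z = 1) {x : g}
    (hx : x ∈ Submodule.span ℝ {Z}) : x = τ x • Z := by
  obtain ⟨r, rfl⟩ := Submodule.mem_span_singleton.1 hx
  simp [hτ]

theorem exists_dual (H : IsAdaptedDecomposition Z C V A) : ∃ τ : Dual ℝ g, τ Z = 1 := by
  by_contra! h
  apply H.ne_zero
  rw [← Module.forall_dual_apply_eq_zero_iff ℝ]
  intro φ
  by_contra h0
  exact h ((φ Z)⁻¹ • φ) (by simp [h0])

theorem eq_zero_left (H : IsAdaptedDecomposition Z C V A) {ξ : Dual ℝ g} (hξ : ξ Z ≠ 0) {y : g}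
    (hy : y ∈ C) (h : ∀ v ∈ V, ξ ⁅v, y⁆ = 0) : y = 0 := by
  refine H.nondegenerate_left y hy fun v hv => ?_
  refine eq_zero_of_mem_span hξ (H.lie_C_V y hy v hv) ?_
  rw [← lie_skew, map_neg, h v hv, neg_zero]

theorem eq_zero_right (H : IsAdaptedDecomposition Z C V A) {ξ : Dual ℝ g} (hξ : ξ Z ≠ 0) {v : g}
    (hv : v ∈ V) (h : ∀ y ∈ C, ξ ⁅y, v⁆ = 0) : v = 0 :=
  H.nondegenerate_right v hv fun y hy =>
    eq_zero_of_mem_span hξ (H.lie_C_V y hy v hv) (h y hy)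

/-- For `ξ(Z) ≠ 0`, the `ξ([·, ·])`-orthogonal space of `C` is `C + A`. -/
theorem exists_add_of_forall_lie (H : IsAdaptedDecomposition Z C V A) {ξ : Dual ℝ g}
    (hξ : ξ Z ≠ 0) {x : g} (h : ∀ y ∈ C, ξ ⁅x, y⁆ = 0) : ∃ y ∈ C, ∃ b ∈ A, x = y + b := by
  obtain ⟨y, hy, v, hv, b, hb, rfl⟩ := H.exists_add x
  have hv0 : v = 0 := by
    refine H.eq_zero_right hξ hv fun u hu => ?_
    have := h u hu
    rw [add_lie, add_lie, H.lie_C_C _ hy _ hu, H.lie_A_C _ hb _ hu, zero_add, add_zero,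
      ← lie_skew, map_neg, neg_eq_zero] at this
    exact this
  exact ⟨y, hy, b, hb, by rw [hv0, add_zero]⟩

/-! ### Generic orbits -/

/-- For `ξ(Z) ≠ 0` the coadjoint orbit of `ξ` has maximal dimension. With `R` the center of `A`,
the stabilizer algebra `g(η)` of any `η` contains the kernel of the map `C + R → V*`,
`x ↦ η([x, ·])`; for `η = ξ` this map is onto, and its kernel is all of `g(ξ)`. -/
theorem finrank_tangent_le [FiniteDimensional ℝ g] (H : IsAdaptedDecomposition Z C V A)
    {ξ : Dual ℝ g} (hξ : ξ Z ≠ 0) (η : Dual ℝ g) :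
    finrank ℝ (coadjointOrbitTangent η) ≤ finrank ℝ (coadjointOrbitTangent ξ) := by
  let R : Submodule ℝ g :=
    { carrier := {b | b ∈ A ∧ ∀ x ∈ A, ⁅b, x⁆ = 0}
      zero_mem' := ⟨zero_mem _, by simp⟩
      add_mem' := fun h1 h2 =>
        ⟨add_mem h1.1 h2.1, fun x hx => by rw [add_lie, h1.2 x hx, h2.2 x hx, add_zero]⟩
      smul_mem' := fun r b h =>
        ⟨A.smul_mem r h.1, fun x hx => by rw [smul_lie, h.2 x hx, smul_zero]⟩ }
  let S := C ⊔ R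
  have hker : finrank ℝ (LinearMap.ker (bracketPairing ξ S V)) ≤
      finrank ℝ (LinearMap.ker (bracketPairing η S V)) := by
    have hsurj : LinearMap.range (bracketPairing ξ S V) = ⊤ := by
      rw [LinearMap.range_eq_top]
      intro f
      obtain ⟨F, hF⟩ := LinearMap.exists_extend f
      obtain ⟨x, hx, h⟩ := exists_forall_apply_lie_eq ξ F C V fun v hv h => by
        rw [H.eq_zero_right hξ hv h, map_zero]
      refine ⟨⟨x, Submodule.mem_sup_left hx⟩, ?_⟩
      ext v
      rw [← hF]
      exact h v v.2
    have h1 := LinearMap.finrank_range_add_finrank_ker (bracketPairing ξ S V)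
    have h2 := LinearMap.finrank_range_add_finrank_ker (bracketPairing η S V)
    have h3 := Submodule.finrank_le (LinearMap.range (bracketPairing η S V))
    rw [hsurj, finrank_top] at h1
    omega
  have h1 : LinearMap.ker
      ((LieModule.toEnd ℝ g (Dual ℝ g) : g →ₗ[ℝ] End ℝ (Dual ℝ g)).flip ξ) ≤
        (LinearMap.ker (bracketPairing ξ S V)).map S.subtype := by
    intro x hx
    rw [mem_ker_toEnd_flip] at hx
    obtain ⟨y, hy, b, hb, rfl⟩ := H.exists_add_of_forall_lie hξ fun y _ => hx y
    have hbR : b ∈ R := by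
      refine ⟨hb, fun x hxA => eq_zero_of_mem_span hξ (H.lie_A_A b hb x hxA) ?_⟩
      have := hx x
      rwa [add_lie, H.lie_C_A hy hxA, zero_add] at this
    refine ⟨⟨y + b, add_mem (Submodule.mem_sup_left hy) (Submodule.mem_sup_right hbR)⟩, ?_, rfl⟩
    rw [SetLike.mem_coe, LinearMap.mem_ker]
    ext v
    exact hx v
  have h2 : (LinearMap.ker (bracketPairing η S V)).map S.subtype ≤ LinearMap.ker
      ((LieModule.toEnd ℝ g (Dual ℝ g) : g →ₗ[ℝ] End ℝ (Dual ℝ g)).flip η) := by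
    rintro _ ⟨⟨x, hxS⟩, hx, rfl⟩
    rw [mem_ker_toEnd_flip]
    intro u
    obtain ⟨y, hy, v, hv, b, hb, rfl⟩ := H.exists_add u
    have hv0 : η ⁅x, v⁆ = 0 := LinearMap.congr_fun hx ⟨v, hv⟩
    obtain ⟨y', hy', b', hb', rfl⟩ := Submodule.mem_sup.1 hxS
    have e : ⁅y' + b', y + v + b⁆ = ⁅y' + b', v⁆ := by
      simp only [add_lie, lie_add, H.lie_C_C _ hy' _ hy, H.lie_C_A hy' hb, H.lie_A_C _ hb'.1 _ hy,
        hb'.2 b hb, zero_add, add_zero]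
    rw [Submodule.subtype_apply, e, hv0]
  have h1' := Submodule.finrank_mono h1
  have h2' := Submodule.finrank_mono h2
  rw [(Submodule.equivMapOfInjective _ S.injective_subtype _).symm.finrank_eq] at h1' h2'
  have r1 := LinearMap.finrank_range_add_finrank_ker
    ((LieModule.toEnd ℝ g (Dual ℝ g) : g →ₗ[ℝ] End ℝ (Dual ℝ g)).flip ξ)
  have r2 := LinearMap.finrank_range_add_finrank_ker
    ((LieModule.toEnd ℝ g (Dual ℝ g) : g →ₗ[ℝ] End ℝ (Dual ℝ g)).flip η)
  unfold coadjointOrbitTangent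
  omega

theorem isGenericCoadjointOrbit [FiniteDimensional ℝ g] (H : IsAdaptedDecomposition Z C V A)
    {ξ : Dual ℝ g} (hξ : ξ Z ≠ 0) : IsGenericCoadjointOrbit (coadjointOrbit ξ) :=
  ⟨ξ, rfl, H.finrank_tangent_le hξ⟩

/-- If `A` has center `ℝ Z`, a functional whose orbit has maximal dimension is nonzero on `Z`,
unless `g` is abelian. -/
theorem apply_ne_zero_or_lie_eq_zero [FiniteDimensional ℝ g] (H : IsAdaptedDecomposition Z C V A)
    (hA : ∀ b ∈ A, (∀ x ∈ A, ⁅b, x⁆ = 0) → b ∈ Submodule.span ℝ {Z}) {ξ : Dual ℝ g}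
    (hξ : ∀ η : Dual ℝ g,
      finrank ℝ (coadjointOrbitTangent η) ≤ finrank ℝ (coadjointOrbitTangent ξ)) :
    ξ Z ≠ 0 ∨ ∀ x y : g, ⁅x, y⁆ = 0 := by
  rw [or_iff_not_imp_left, not_not]
  intro hZ
  obtain ⟨τ, hτ⟩ := H.exists_dual
  have hτ0 : τ Z ≠ 0 := by rw [hτ]; exact one_ne_zero
  have r1 := LinearMap.finrank_range_add_finrank_ker
    ((LieModule.toEnd ℝ g (Dual ℝ g) : g →ₗ[ℝ] End ℝ (Dual ℝ g)).flip ξ)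
  have r2 := LinearMap.finrank_range_add_finrank_ker
    ((LieModule.toEnd ℝ g (Dual ℝ g) : g →ₗ[ℝ] End ℝ (Dual ℝ g)).flip τ)
  have hle := hξ τ
  unfold coadjointOrbitTangent at hle
  have h1 : LinearMap.ker
      ((LieModule.toEnd ℝ g (Dual ℝ g) : g →ₗ[ℝ] End ℝ (Dual ℝ g)).flip τ) ≤
        Submodule.span ℝ {Z} := by
    intro x hx
    rw [mem_ker_toEnd_flip] at hx
    obtain ⟨y, hy, b, hb, rfl⟩ := H.exists_add_of_forall_lie hτ0 fun y _ => hx y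
    have hbZ := hA b hb fun x hxA => eq_zero_of_mem_span hτ0 (H.lie_A_A b hb x hxA) (by
      have := hx x
      rwa [add_lie, H.lie_C_A hy hxA, zero_add] at this)
    have hy0 : y = 0 := H.eq_zero_left hτ0 hy fun v _ => by
      have := hx v
      rw [add_lie, ← lie_skew y, ← lie_skew b, H.mem_center_iff.1 hbZ v, neg_zero, add_zero,
        map_neg, neg_eq_zero] at this
      exact this
    rwa [hy0, zero_add]
  have h2 : Submodule.span ℝ {Z} ≤ LinearMap.ker
      ((LieModule.toEnd ℝ g (Dual ℝ g) : g →ₗ[ℝ] End ℝ (Dual ℝ g)).flip ξ) := by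
    rw [Submodule.span_singleton_le_iff_mem, mem_ker_toEnd_flip]
    intro y
    rw [H.Z_lie, map_zero]
  -- The stabilizer algebra of `ξ` is the center, but it contains `C` since `ξ` vanishes on `Z`.
  have h3 := Submodule.eq_of_le_of_finrank_le h2
    ((by omega : _ ≤ _).trans (Submodule.finrank_mono h1))
  have hspan : ∀ x ∈ Submodule.span ℝ {Z}, ξ x = 0 := by
    intro x hx
    obtain ⟨r, rfl⟩ := Submodule.mem_span_singleton.1 hx
    rw [map_smul, hZ, smul_zero]
  have hC : ∀ y ∈ C, y = 0 := by
    intro y hy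
    have : y ∈ Submodule.span ℝ {Z} := by
      rw [h3, mem_ker_toEnd_flip]
      intro x
      rw [← lie_skew]
      exact hspan _ (neg_mem (H.lie_C_mem x hy))
    refine H.nondegenerate_left y hy fun v hv => ?_
    rw [← lie_skew, H.mem_center_iff.1 this, neg_zero]
  have hV : ∀ v ∈ V, v = 0 := fun v hv => H.nondegenerate_right v hv fun y hy => by
    rw [hC y hy, zero_lie]
  have hgA : ∀ x : g, x ∈ A := by
    intro x
    obtain ⟨y, hy, v, hv, b, hb, rfl⟩ := H.exists_add x
    rwa [hC y hy, hV v hv, zero_add, zero_add]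
  intro x y
  have hy : y ∈ Submodule.span ℝ {Z} := by
    rw [h3, mem_ker_toEnd_flip]
    exact fun u => hspan _ (H.lie_A_A _ (hgA y) _ (hgA u))
  exact H.mem_center_iff.1 hy x

end IsAdaptedDecomposition

/-! ### Flatness of orbits -/

section Orbits

variable {g : Type*} [LieRing g] [LieAlgebra ℝ g]

theorem mem_coadjointOrbit_self (ξ : Dual ℝ g) : ξ ∈ coadjointOrbit ξ :=
  mem_coadjointOrbit_iff.2 ⟨1, one_mem _, fun _ => rfl⟩

theorem mem_coadjointOrbit_trans {ξ η ζ : Dual ℝ g} (h₁ : η ∈ coadjointOrbit ξ)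
    (h₂ : ζ ∈ coadjointOrbit η) : ζ ∈ coadjointOrbit ξ := by
  rw [mem_coadjointOrbit_iff] at *
  obtain ⟨φ, hφ, h1⟩ := h₁
  obtain ⟨ψ, hψ, h2⟩ := h₂
  exact ⟨φ * ψ, mul_mem hφ hψ, fun x => by rw [h2, h1]; rfl⟩

theorem exists_mem_coadjointOrbit (ξ : Dual ℝ g) (X : g) (h : ∀ x : g, ⁅X, ⁅X, ⁅X, x⁆⁆⁆ = 0) :
    ∃ η ∈ coadjointOrbit ξ, ∀ x, η x = ξ x + ξ ⁅X, x⁆ + 2⁻¹ * ξ ⁅X, ⁅X, x⁆⁆ :=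
  ⟨ξ ∘ₗ (expAd X h : g →ₗ[ℝ] g),
    mem_coadjointOrbit_iff.2 ⟨expAd X h, expAd_mem_adjointGroup X h, fun _ => rfl⟩, fun x => by
      simp [expAd_apply]⟩

end Orbits

namespace IsAdaptedDecomposition

variable {g : Type*} [LieRing g] [LieAlgebra ℝ g] {Z : g} {C V A : Submodule ℝ g}

theorem apply_Z_of_mem_adjointGroup (H : IsAdaptedDecomposition Z C V A) {φ : g ≃ₗ[ℝ] g}
    (hφ : φ ∈ adjointGroup g) : φ Z = Z := by
  induction hφ using Subgroup.closure_induction with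
  | mem φ hφ =>
    obtain ⟨X, hX⟩ := hφ
    rw [hX.apply_eq fun x => H.lie_lie_lie X X X x, H.lie_Z]
    simp
  | one => rfl
  | mul φ ψ _ _ h1 h2 => rw [LinearEquiv.mul_apply, h2, h1]
  | inv φ _ h =>
    apply φ.injective
    rw [h, ← LinearEquiv.mul_apply, mul_inv_cancel, LinearEquiv.coe_one, id]

theorem apply_Z_of_mem_coadjointOrbit (H : IsAdaptedDecomposition Z C V A) {ξ η : Dual ℝ g}
    (h : η ∈ coadjointOrbit ξ) : η Z = ξ Z := by
  obtain ⟨φ, hφ, h⟩ := mem_coadjointOrbit_iff.1 h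
  rw [h, H.apply_Z_of_mem_adjointGroup hφ]

/-- If `A` has center `ℝ Z`, the coadjoint orbit of `ξ` with `ξ(Z) ≠ 0` is the hyperplane of all
functionals that agree with `ξ` on `Z`. A functional in it is reached from `ξ` by `e^{ad X}` with
`X` in `V`, in `A` and in `C`, which adjust the values on `C`, on `A` and on `V`, in this order;
each step keeps the values adjusted before. -/
theorem mem_coadjointOrbit [FiniteDimensional ℝ g] (H : IsAdaptedDecomposition Z C V A)
    (hA : ∀ b ∈ A, (∀ x ∈ A, ⁅b, x⁆ = 0) → b ∈ Submodule.span ℝ {Z})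
    {ξ η : Dual ℝ g} (hξ : ξ Z ≠ 0) (h : η Z = ξ Z) : η ∈ coadjointOrbit ξ := by
  have cube (X : g) := H.lie_lie_lie X X X
  obtain ⟨v, hv, hvC⟩ := exists_forall_apply_lie_eq ξ (η - ξ) V C fun y hy h => by
    rw [H.eq_zero_left hξ hy h, map_zero]
  obtain ⟨ξ₁, hξ₁, e₁⟩ := exists_mem_coadjointOrbit ξ v (cube v)
  have hZ₁ := H.apply_Z_of_mem_coadjointOrbit hξ₁
  have hC₁ : ∀ y ∈ C, ξ₁ y = η y := by
    intro y hy
    rw [e₁, H.mem_center_iff.1 (H.lie_V_C hv hy), hvC y hy]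
    simp
  obtain ⟨b, hb, hbA⟩ := exists_forall_apply_lie_eq ξ₁ (η - ξ₁) A A fun x hx h' => by
    have hxZ := hA x hx fun y hy => by
      refine eq_zero_of_mem_span (ξ := ξ₁) (by rwa [hZ₁]) (H.lie_A_A x hx y hy) ?_
      rw [← lie_skew, map_neg, h' y hy, neg_zero]
    obtain ⟨r, rfl⟩ := Submodule.mem_span_singleton.1 hxZ
    simp [h, hZ₁]
  obtain ⟨ξ₂, hξ₂, e₂⟩ := exists_mem_coadjointOrbit ξ₁ b (cube b)
  have hZ₂ := H.apply_Z_of_mem_coadjointOrbit hξ₂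
  have hC₂ : ∀ y ∈ C, ξ₂ y = η y := by
    intro y hy
    rw [e₂, H.lie_A_C b hb y hy, hC₁ y hy]
    simp
  have hA₂ : ∀ x ∈ A, ξ₂ x = η x := by
    intro x hx
    rw [e₂, H.mem_center_iff.1 (H.lie_A_A b hb x hx), hbA x hx]
    simp
  obtain ⟨y, hy, hyV⟩ := exists_forall_apply_lie_eq ξ₂ (η - ξ₂) C V fun v hv h => by
    rw [H.eq_zero_right (by rwa [hZ₂, hZ₁]) hv h, map_zero]
  obtain ⟨ξ₃, hξ₃, e₃⟩ := exists_mem_coadjointOrbit ξ₂ y (cube y)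
  have : ξ₃ = η := by
    ext x
    obtain ⟨y', hy', v', hv', b', hb', rfl⟩ := H.exists_add x
    rw [e₃]
    simp only [lie_add, H.lie_C_C y hy y' hy', H.lie_C_A hy hb',
      H.mem_center_iff.1 (H.lie_C_V y hy v' hv'), map_add, hyV v' hv', hC₂ y' hy', hA₂ b' hb',
      lie_zero, map_zero, LinearMap.sub_apply]
    ring
  rw [← this]
  exact mem_coadjointOrbit_trans (mem_coadjointOrbit_trans hξ₁ hξ₂) hξ₃

theorem hasFlatGenericCoadjointOrbits [FiniteDimensional ℝ g]
    (H : IsAdaptedDecomposition Z C V A)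
    (hA : ∀ b ∈ A, (∀ x ∈ A, ⁅b, x⁆ = 0) → b ∈ Submodule.span ℝ {Z}) :
    HasFlatGenericCoadjointOrbits g := by
  rintro O ⟨ξ, rfl, hgen⟩
  rcases H.apply_ne_zero_or_lie_eq_zero hA hgen with hξ | h0
  · refine ⟨AffineSubspace.mk' ξ (LinearMap.ker (Dual.eval ℝ g Z)), ?_⟩
    ext η
    rw [SetLike.mem_coe, AffineSubspace.mem_mk', LinearMap.mem_ker, Dual.eval_apply, vsub_eq_sub,
      LinearMap.sub_apply, sub_eq_zero]
    exact ⟨fun h => H.mem_coadjointOrbit hA hξ h, fun h => H.apply_Z_of_mem_coadjointOrbit h⟩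
  · -- The Lie algebra is abelian, and every orbit is a point.
    refine ⟨AffineSubspace.mk' ξ ⊥, ?_⟩
    ext η
    rw [SetLike.mem_coe, AffineSubspace.mem_mk', Submodule.mem_bot, vsub_eq_sub, sub_eq_zero]
    constructor
    · rintro rfl
      exact mem_coadjointOrbit_self η
    · intro h
      ext x
      have hx : x ∈ Submodule.span ℝ {Z} := H.mem_center_iff.2 fun y => h0 y x
      obtain ⟨r, rfl⟩ := Submodule.mem_span_singleton.1 hx
      rw [map_smul, map_smul, H.apply_Z_of_mem_coadjointOrbit h]

theorem lie_lie_comm (H : IsAdaptedDecomposition Z C V A) {b v w : g} (hb : b ∈ A) (hv : v ∈ V)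
    (hw : w ∈ V) : ⁅v, ⁅w, b⁆⁆ = ⁅w, ⁅v, b⁆⁆ := by
  rw [leibniz_lie, H.lie_C_A (H.lie_V_V v hv w hw) hb, zero_add]

/-- On `C` and on a central element `b` of `A`, the adjoint group acts through the operators
`e^{ad v}` with `v ∈ V`. -/
theorem exists_mem_V_of_mem_adjointGroup (H : IsAdaptedDecomposition Z C V A) {b : g}
    (hb : b ∈ A) (hbA : ∀ x ∈ A, ⁅b, x⁆ = 0) {φ : g ≃ₗ[ℝ] g} (hφ : φ ∈ adjointGroup g) :
    ∃ v ∈ V, (∀ y ∈ C, φ y = y + ⁅v, y⁆) ∧ φ b = b + ⁅v, b⁆ + (2⁻¹ : ℝ) • ⁅v, ⁅v, b⁆⁆ := by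
  have hfix : ∀ φ ∈ adjointGroup g, ∀ x ∈ Submodule.span ℝ {Z}, φ x = x := by
    intro φ hφ x hx
    obtain ⟨r, rfl⟩ := Submodule.mem_span_singleton.1 hx
    rw [map_smul, H.apply_Z_of_mem_adjointGroup hφ]
  induction hφ using Subgroup.closure_induction with
  | mem φ hφ =>
    obtain ⟨X, hX⟩ := hφ
    have e := hX.apply_eq fun x => H.lie_lie_lie X X X x
    obtain ⟨y, hy, v, hv, a, ha, rfl⟩ := H.exists_add X
    have h1 : ∀ u ∈ C, ⁅y + v + a, u⁆ = ⁅v, u⁆ := by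
      intro u hu
      rw [add_lie, add_lie, H.lie_C_C y hy u hu, H.lie_A_C a ha u hu, zero_add, add_zero]
    have h2 : ⁅y + v + a, b⁆ = ⁅v, b⁆ := by
      rw [add_lie, add_lie, H.lie_C_A hy hb, ← lie_skew a, hbA a ha, neg_zero, zero_add, add_zero]
    refine ⟨v, hv, fun u hu => ?_, ?_⟩
    · rw [e, h1 u hu, H.mem_center_iff.1 (H.lie_V_C hv hu), smul_zero, add_zero]
    · rw [e, h2, h1 _ (H.lie_V_A hv hb)]
  | one => exact ⟨0, zero_mem _, by simp, by simp⟩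
  | mul φ ψ hφ hψ h1 h2 =>
    obtain ⟨v, hv, hvC, hvb⟩ := h1
    obtain ⟨w, hw, hwC, hwb⟩ := h2
    refine ⟨v + w, add_mem hv hw, fun y hy => ?_, ?_⟩
    · rw [LinearEquiv.mul_apply, hwC y hy, map_add, hvC y hy, hfix φ hφ _ (H.lie_V_C hw hy),
        add_lie, add_assoc]
    · have hwbC := H.lie_V_A hw hb
      rw [LinearEquiv.mul_apply, hwb, map_add, map_add, map_smul, hvb, hvC _ hwbC,
        hfix φ hφ _ (H.lie_V_C hw hwbC)]
      simp only [add_lie, lie_add, H.lie_lie_comm hb hw hv]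
      module
  | inv φ hφ h =>
    obtain ⟨v, hv, hvC, hvb⟩ := h
    have hinv : ∀ x y : g, φ y = x → φ⁻¹ x = y := by
      rintro _ y rfl
      rw [← LinearEquiv.mul_apply, inv_mul_cancel, LinearEquiv.coe_one, id]
    have hvbC := H.lie_V_A hv hb
    refine ⟨-v, neg_mem hv, fun y hy => hinv _ _ ?_, hinv _ _ ?_⟩
    · rw [map_add, neg_lie, map_neg, hvC y hy, hfix φ hφ _ (H.lie_V_C hv hy)]
      abel
    · simp only [neg_lie, lie_neg, neg_neg, map_add, map_neg, map_smul, hvb, hvC _ hvbC,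
        hfix φ hφ _ (H.lie_V_C hv hvbC)]
      module

/-- If the orbit of some `ξ` with `ξ(Z) ≠ 0` is flat, then `A` has center `ℝ Z`. For a central
element `b` of `A`, the values of points of the orbit at `b` depend quadratically on their
restrictions to `C`. In an affine space this dependence is affine, so the quadratic form
`v ↦ ξ([v, [v, b]])` vanishes, and by polarization `b` is central in `g`. -/
theorem mem_span_of_isFlat (H : IsAdaptedDecomposition Z C V A) {ξ : Dual ℝ g} (hξ : ξ Z ≠ 0)
    (hflat : IsFlat (coadjointOrbit ξ)) {b : g} (hb : b ∈ A) (hbA : ∀ x ∈ A, ⁅b, x⁆ = 0) :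
    b ∈ Submodule.span ℝ {Z} := by
  obtain ⟨E, hE⟩ := hflat
  have hquad : ∀ v ∈ V, ξ ⁅v, ⁅v, b⁆⁆ = 0 := by
    intro v hv
    obtain ⟨η, hη, e⟩ := exists_mem_coadjointOrbit ξ v (H.lie_lie_lie v v v)
    -- The midpoint of `ξ` and `ξ ∘ e^{ad v}` has parameter `w = v / 2`.
    have hmid : AffineMap.lineMap ξ η (2⁻¹ : ℝ) ∈ coadjointOrbit ξ := by
      rw [← hE] at hη ⊢
      refine AffineMap.lineMap_mem _ ?_ hη
      rw [← SetLike.mem_coe, hE]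
      exact mem_coadjointOrbit_self ξ
    rw [AffineMap.lineMap_apply_module'] at hmid
    obtain ⟨φ, hφ, hφe⟩ := mem_coadjointOrbit_iff.1 hmid
    obtain ⟨w, hw, hwC, hwb⟩ := H.exists_mem_V_of_mem_adjointGroup hb hbA hφ
    have hwv : w - (2⁻¹ : ℝ) • v = 0 := by
      refine H.eq_zero_right hξ (sub_mem hw (V.smul_mem _ hv)) fun y hy => ?_
      have := hφe y
      simp only [LinearMap.add_apply, LinearMap.smul_apply, LinearMap.sub_apply, smul_eq_mul, e,
        hwC y hy, map_add, H.mem_center_iff.1 (H.lie_V_C hv hy), map_zero] at this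
      rw [← lie_skew, sub_lie, smul_lie, map_neg, map_sub, map_smul, smul_eq_mul]
      linarith
    have := hφe b
    rw [sub_eq_zero] at hwv
    simp only [LinearMap.add_apply, LinearMap.smul_apply, LinearMap.sub_apply, smul_eq_mul, e,
      hwb, hwv, map_add, map_smul, smul_lie, lie_smul] at this
    linarith
  have hpol : ∀ v ∈ V, ∀ w ∈ V, ξ ⁅v, ⁅w, b⁆⁆ = 0 := by
    intro v hv w hw
    have := hquad (v + w) (add_mem hv hw)
    simp only [add_lie, lie_add, map_add, hquad v hv, hquad w hw, H.lie_lie_comm hb hw hv] at this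
    linarith
  rw [H.mem_center_iff]
  intro x
  obtain ⟨y, hy, v, hv, a, ha, rfl⟩ := H.exists_add x
  rw [add_lie, add_lie, H.lie_C_A hy hb, ← lie_skew a, hbA a ha,
    H.eq_zero_left hξ (H.lie_V_A hv hb) fun u hu => hpol u hu v hv]
  simp

/-! ### Maximal abelian subspaces, Heisenberg algebras and polarizations -/

/-- There is a maximal abelian subspace of `A`, that is, one that is its own centralizer in `A`. -/
theorem exists_maximal_abelian [FiniteDimensional ℝ g] (H : IsAdaptedDecomposition Z C V A) :
    ∃ L : Submodule ℝ g, L ≤ A ∧ Z ∈ L ∧ (∀ x ∈ L, ∀ y ∈ L, ⁅x, y⁆ = 0) ∧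
      ∀ b ∈ A, (∀ x ∈ L, ⁅b, x⁆ = 0) → b ∈ L := by
  obtain ⟨L, hZL, ⟨hLA, hL⟩, hmax⟩ := exists_maximal_ge_of_wellFoundedGT
    (fun W : Submodule ℝ g => W ≤ A ∧ ∀ x ∈ W, ∀ y ∈ W, ⁅x, y⁆ = 0) (Submodule.span ℝ {Z})
    ⟨H.span_le, fun x _ y hy => H.mem_center_iff.1 hy x⟩
  refine ⟨L, hLA, hZL (Submodule.mem_span_singleton_self Z), hL, fun b hb h => ?_⟩
  have hP : L ⊔ Submodule.span ℝ {b} ≤ A ∧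
      ∀ x ∈ L ⊔ Submodule.span ℝ {b}, ∀ y ∈ L ⊔ Submodule.span ℝ {b}, ⁅x, y⁆ = 0 := by
    refine ⟨sup_le hLA ((Submodule.span_singleton_le_iff_mem b A).2 hb), ?_⟩
    have h' : ∀ x ∈ L, ⁅x, b⁆ = 0 := fun x hx => by rw [← lie_skew, h x hx, neg_zero]
    intro x hx y hy
    obtain ⟨x₁, hx₁, x₂, hx₂, rfl⟩ := Submodule.mem_sup.1 hx
    obtain ⟨y₁, hy₁, y₂, hy₂, rfl⟩ := Submodule.mem_sup.1 hy
    obtain ⟨r, rfl⟩ := Submodule.mem_span_singleton.1 hx₂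
    obtain ⟨s, rfl⟩ := Submodule.mem_span_singleton.1 hy₂
    simp [hL x₁ hx₁ y₁ hy₁, h y₁ hy₁, h' x₁ hx₁]
  exact hmax hP le_sup_left (Submodule.mem_sup_right (Submodule.mem_span_singleton_self b))

/-- A subalgebra `a ≠ ℝ Z` with center `ℝ Z` and `[a, a] ⊆ ℝ Z` is a Heisenberg algebra. The `Yᵢ`
are a basis of a complement of `Z` in a maximal abelian subspace. For the `Xᵢ`, dual elements `xᵢ`
are corrected to commuting ones, `Xᵢ = xᵢ + ½ ∑ₗ τ([xᵢ, xₗ]) Yₗ`, where `τ(Z) = 1`. -/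
theorem isHeisenbergAlgebra [FiniteDimensional ℝ g] {a : LieSubalgebra ℝ g}
    (H : IsAdaptedDecomposition Z C V a.toSubmodule)
    (hA : ∀ b ∈ a, (∀ x ∈ a, ⁅b, x⁆ = 0) → b ∈ Submodule.span ℝ {Z})
    (hne : a.toSubmodule ≠ Submodule.span ℝ {Z}) : IsHeisenbergAlgebra ℝ a := by
  obtain ⟨τ, hτ⟩ := H.exists_dual
  have hτ0 : τ Z ≠ 0 := by rw [hτ]; exact one_ne_zero
  obtain ⟨L, hLA, hZL, hLL, hLmax⟩ := H.exists_maximal_abelian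
  have hval : ∀ x ∈ a, ∀ y ∈ a, ⁅x, y⁆ = τ ⁅x, y⁆ • Z := fun x hx y hy =>
    eq_smul_of_mem_span hτ (H.lie_A_A x hx y hy)
  let L₀ := L ⊓ LinearMap.ker τ
  let Y := finBasis ℝ L₀
  have hYL : ∀ i, (Y i : g) ∈ L := fun i => (Y i).2.1
  have hYτ : ∀ i, τ (Y i : g) = 0 := fun i => (Y i).2.2
  have hx : ∀ i, ∃ x ∈ a.toSubmodule, ∀ j, τ ⁅x, (Y j : g)⁆ = if i = j then 1 else 0 := by
    intro i
    obtain ⟨F, hF⟩ := LinearMap.exists_extend (Y.coord i)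
    have hFY : ∀ y : L₀, F y = Y.coord i y := fun y => LinearMap.congr_fun hF y
    -- Subtracting `F(Z) τ` makes the coordinate functional vanish on `Z`.
    obtain ⟨x, hx, h⟩ := exists_forall_apply_lie_eq τ (F - F Z • τ) a.toSubmodule L
      fun y hy h => by
        have : y ∈ Submodule.span ℝ {Z} := hA y (hLA hy) fun x hx => by
          refine eq_zero_of_mem_span hτ0 (H.lie_A_A y (hLA hy) x hx) ?_
          rw [← lie_skew, map_neg, h x hx, neg_zero]
        obtain ⟨r, rfl⟩ := Submodule.mem_span_singleton.1 this
        simp [hτ]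
    refine ⟨x, hx, fun j => ?_⟩
    rw [h _ (hYL j)]
    simp [hFY, hYτ, Finsupp.single_apply, eq_comm]
  choose x hxa hxY using hx
  have hYx : ∀ i j, τ ⁅(Y j : g), x i⁆ = if i = j then -1 else 0 := fun i j => by
    rw [← lie_skew, map_neg, hxY]
    split_ifs <;> simp
  let X := fun i => x i + (2⁻¹ : ℝ) • ∑ l, τ ⁅x i, x l⁆ • (Y l : g)
  have hXa : ∀ i, X i ∈ a := fun i => add_mem (hxa i)
    (a.smul_mem _ (sum_mem fun l _ => a.smul_mem _ (hLA (hYL l))))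
  have hYY : ∀ i j, ⁅(Y i : g), (Y j : g)⁆ = 0 := fun i j => hLL _ (hYL i) _ (hYL j)
  have hXY' : ∀ i j, τ ⁅X i, (Y j : g)⁆ = if i = j then 1 else 0 := fun i j => by
    simp [X, sum_lie, hYY, hxY]
  have hXX' : ∀ i j, τ ⁅X i, X j⁆ = 0 := fun i j => by
    have hs : τ ⁅x j, x i⁆ = - τ ⁅x i, x j⁆ := by rw [← lie_skew, map_neg]
    simp [X, sum_lie, lie_sum, hYY, hxY, hYx, hs]
    ring
  have hXY : ∀ i j, ⁅X i, (Y j : g)⁆ = if i = j then Z else 0 := fun i j => by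
    rw [hval _ (hXa i) _ (hLA (hYL j)), hXY']
    split_ifs <;> simp
  have hXX : ∀ i j, ⁅X i, X j⁆ = 0 := fun i j => by
    rw [hval _ (hXa i) _ (hXa j), hXX', zero_smul]
  -- An element of `L` differs from a multiple of `Z` by an element of `L₀`.
  have hLspan : ∀ y ∈ L, ∃ f : Fin (finrank ℝ L₀) → ℝ, y = τ y • Z + ∑ i, f i • (Y i : g) := by
    intro y hy
    have hm : y - τ y • Z ∈ L₀ := ⟨sub_mem hy (L.smul_mem _ hZL), by simp [hτ]⟩
    refine ⟨fun i => Y.repr ⟨_, hm⟩ i, ?_⟩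
    have := congrArg (Submodule.subtype L₀) (Y.sum_repr ⟨_, hm⟩)
    simp only [map_sum, map_smul, Submodule.subtype_apply] at this
    rw [this]
    abel
  have hspan : ∀ b ∈ a, ∃ (r : ℝ) (f e : Fin (finrank ℝ L₀) → ℝ),
      b = r • Z + (∑ i, f i • (Y i : g) + ∑ i, e i • X i) := by
    intro b hb
    have hm : b - ∑ i, τ ⁅b, (Y i : g)⁆ • X i ∈ L := by
      have hma : b - ∑ i, τ ⁅b, (Y i : g)⁆ • X i ∈ a :=
        sub_mem hb (sum_mem fun l _ => a.smul_mem _ (hXa l))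
      refine hLmax _ hma fun y hy => ?_
      rw [hval _ hma _ (hLA hy)]
      obtain ⟨f, hf⟩ := hLspan y hy
      rw [hf]
      simp [lie_sum, sum_lie, H.lie_Z, hXY', mul_comm]
    obtain ⟨f, hf⟩ := hLspan _ hm
    exact ⟨_, f, fun i => τ ⁅b, (Y i : g)⁆, by rw [← add_assoc, ← hf]; abel⟩
  let w : Unit ⊕ Fin (finrank ℝ L₀) ⊕ Fin (finrank ℝ L₀) → a :=
    Sum.elim (fun _ => ⟨Z, H.mem_A⟩)
      (Sum.elim (fun i => ⟨Y i, hLA (hYL i)⟩) (fun i => ⟨X i, hXa i⟩))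
  have hli : LinearIndependent ℝ w := by
    rw [Fintype.linearIndependent_iff]
    intro f hf
    have hf' := congrArg (a.toSubmodule.subtype) hf
    simp [w, Fintype.sum_sum_type] at hf'
    have hX0 : ∀ i, f (Sum.inr (Sum.inr i)) = 0 := fun i => by
      have := congrArg (fun u => τ ⁅u, (Y i : g)⁆) hf'
      simpa [sum_lie, H.Z_lie, hYY, hXY'] using this
    have hY0 : ∀ i, f (Sum.inr (Sum.inl i)) = 0 := fun i => by
      have := congrArg (fun u => τ ⁅X i, u⁆) hf'
      simpa [lie_sum, H.lie_Z, hXX', hXY'] using this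
    rintro (u | i | i)
    · simpa [hX0, hY0, H.ne_zero] using hf'
    · exact hY0 i
    · exact hX0 i
  have hsp : ⊤ ≤ Submodule.span ℝ (Set.range w) := by
    rintro ⟨b, hb⟩ -
    obtain ⟨r, f, e, h⟩ := hspan b hb
    have : (⟨b, hb⟩ : a) = ∑ i, (Sum.elim (fun _ => r) (Sum.elim f e) i) • w i := by
      apply Subtype.ext
      rw [AddSubmonoidClass.coe_finsetSum, Fintype.sum_sum_type, Fintype.sum_sum_type]
      simpa [w] using h
    rw [this]
    exact sum_mem fun i _ => Submodule.smul_mem _ _ (Submodule.subset_span ⟨i, rfl⟩)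
  refine ⟨finrank ℝ L₀, ?_, ⟨Z, H.mem_A⟩, fun i => ⟨Y i, hLA (hYL i)⟩, fun i => ⟨X i, hXa i⟩,
    Basis.mk hli hsp, Basis.coe_mk hli hsp, fun u => Subtype.ext (H.Z_lie u),
    fun i j => Subtype.ext (hXX i j), fun i j => Subtype.ext (hYY i j), fun i j => ?_⟩
  · rw [Nat.one_le_iff_ne_zero]
    intro h0
    apply hne
    refine le_antisymm (fun b hb => ?_) H.span_le
    obtain ⟨r, f, e, h⟩ := hspan b hb
    have : IsEmpty (Fin (finrank ℝ L₀)) := by rw [h0]; infer_instance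
    rw [h]
    simpa using Submodule.smul_mem _ r (Submodule.mem_span_singleton_self Z)
  · apply Subtype.ext
    rw [LieSubalgebra.coe_bracket]
    simp only [hXY]
    split_ifs <;> rfl

/-- The center of a Heisenberg algebra containing the central element `Z ≠ 0` of `g` is `ℝ Z`. -/
theorem mem_span_of_isHeisenbergAlgebra {a : LieSubalgebra ℝ g}
    (H : IsAdaptedDecomposition Z C V a.toSubmodule) (ha : IsHeisenbergAlgebra ℝ a) {b : g}
    (hb : b ∈ a) (hba : ∀ x ∈ a, ⁅b, x⁆ = 0) : b ∈ Submodule.span ℝ {Z} := by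
  obtain ⟨n, -, W, Y, X, B, hB, hW, hXX, hYY, hXY⟩ := ha
  have hYX : ∀ i j, ⁅Y i, X j⁆ = if j = i then -W else 0 := fun i j => by
    rw [← lie_skew, hXY]
    split_ifs <;> simp
  have hW0 : W ≠ 0 := by
    have := B.ne_zero (Sum.inl ())
    rwa [hB] at this
  have key : ∀ u : a, (∀ y : a, ⁅u, y⁆ = 0) → ∃ r : ℝ, u = r • W := by
    intro u hu
    have hs := B.sum_repr u
    simp only [hB, Fintype.sum_sum_type, Sum.elim_inl, Sum.elim_inr, Finset.univ_unique,
      Finset.sum_singleton] at hs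
    have hX0 : ∀ i, B.repr u (Sum.inr (Sum.inr i)) = 0 := fun i => by
      have := hu (Y i)
      rw [← hs] at this
      simpa [sum_lie, hW, hYY, hXY, hW0] using this
    have hY0 : ∀ i, B.repr u (Sum.inr (Sum.inl i)) = 0 := fun i => by
      have := hu (X i)
      rw [← hs] at this
      simpa [sum_lie, hW, hYX, hXX, hW0] using this
    exact ⟨B.repr u (Sum.inl default), hs.symm.trans (by simp [hX0, hY0])⟩
  obtain ⟨r, hr⟩ := key ⟨Z, H.mem_A⟩ fun y => Subtype.ext (H.Z_lie y)
  obtain ⟨s, hs⟩ := key ⟨b, hb⟩ fun y => Subtype.ext (hba y y.2)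
  have hr' : Z = r • (W : g) := congrArg Subtype.val hr
  have hs' : b = s • (W : g) := congrArg Subtype.val hs
  have hr0 : r ≠ 0 := by
    rintro rfl
    exact H.ne_zero (by rw [hr', zero_smul])
  refine Submodule.mem_span_singleton.2 ⟨s / r, ?_⟩
  rw [hs', hr', smul_smul, div_mul_cancel₀ s hr0]

/-- The sum of `C` and a maximal abelian subspace of `A` is a maximal abelian ideal. It is a
polarization at every `ξ` with `ξ(Z) ≠ 0`. -/
theorem exists_ideal_isPolarization [FiniteDimensional ℝ g] (H : IsAdaptedDecomposition Z C V A) :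
    ∃ p : LieIdeal ℝ g, Maximal (fun q : LieIdeal ℝ g => IsLieAbelian q) p ∧
      ∀ ξ : Dual ℝ g, ξ Z ≠ 0 → IsPolarization (p : LieSubalgebra ℝ g) ξ := by
  obtain ⟨L, hLA, hZL, hLL, hLmax⟩ := H.exists_maximal_abelian
  let p : LieIdeal ℝ g :=
    { C ⊔ L with
      lie_mem := fun {x u} hu => by
        have h0 : Submodule.span ℝ {Z} ≤ C ⊔ L :=
          ((Submodule.span_singleton_le_iff_mem Z L).2 hZL).trans le_sup_right
        obtain ⟨y, hy, b, hb, rfl⟩ := Submodule.mem_sup.1 hu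
        rw [lie_add]
        exact add_mem (h0 (H.lie_C_mem x hy)) (by
          obtain ⟨y', hy', v, hv, b', hb', rfl⟩ := H.exists_add x
          rw [add_lie, add_lie, H.lie_C_A hy' (hLA hb), zero_add]
          exact add_mem (Submodule.mem_sup_left (H.lie_V_A hv (hLA hb)))
            (h0 (H.lie_A_A b' hb' b (hLA hb)))) }
  have hp : ∀ x ∈ C ⊔ L, ∀ y ∈ C ⊔ L, ⁅x, y⁆ = 0 := by
    intro x hx y hy
    obtain ⟨x₁, hx₁, x₂, hx₂, rfl⟩ := Submodule.mem_sup.1 hx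
    obtain ⟨y₁, hy₁, y₂, hy₂, rfl⟩ := Submodule.mem_sup.1 hy
    rw [add_lie, lie_add, lie_add, H.lie_C_C x₁ hx₁ y₁ hy₁, H.lie_C_A hx₁ (hLA hy₂),
      H.lie_A_C x₂ (hLA hx₂) y₁ hy₁, hLL x₂ hx₂ y₂ hy₂]
    simp
  have hmax : ∀ ξ : Dual ℝ g, ξ Z ≠ 0 → ∀ W : Submodule ℝ g,
      (∀ x ∈ W, ∀ y ∈ W, ξ ⁅x, y⁆ = 0) → C ⊔ L ≤ W → W ≤ C ⊔ L := by
    intro ξ hξ W hW hle x hx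
    obtain ⟨y, hy, b, hb, rfl⟩ := H.exists_add_of_forall_lie hξ fun u hu =>
      hW x hx u (hle (Submodule.mem_sup_left hu))
    refine add_mem (Submodule.mem_sup_left hy) (Submodule.mem_sup_right (hLmax b hb fun u hu => ?_))
    refine eq_zero_of_mem_span hξ (H.lie_A_A b hb u (hLA hu)) ?_
    have := hW _ hx u (hle (Submodule.mem_sup_right hu))
    rwa [add_lie, H.lie_C_A hy (hLA hu), zero_add] at this
  refine ⟨p, ⟨⟨fun x y => Subtype.ext (hp x x.2 y y.2)⟩, fun q hq hpq => ?_⟩, fun ξ hξ =>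
    ⟨fun x hx y hy => by rw [hp x hx y hy, map_zero], fun W hW hle => hmax ξ hξ W hW hle⟩⟩
  obtain ⟨τ, hτ⟩ := H.exists_dual
  refine hmax τ (by rw [hτ]; exact one_ne_zero) q.toSubmodule (fun x hx y hy => ?_) hpq
  have := hq.trivial ⟨x, hx⟩ ⟨y, hy⟩
  rw [show ⁅x, y⁆ = 0 from congrArg Subtype.val this, map_zero]

end IsAdaptedDecomposition

end KirillovLemma

open KirillovLemma in
theorem theorem5p2 {g : Type*} [LieRing g] [LieAlgebra ℝ g] [FiniteDimensional ℝ g]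
    (k a : LieSubalgebra ℝ g) (z c V : Submodule ℝ k)
    (hg : IsReducedSemidirectProduct k a)
    (hγ : IsGradingOfTypeAPlus ℝ z c V)
    (ha_nilp : LieRing.IsNilpotent a)
    (ha_lie : ∀ x ∈ a, ∀ y ∈ a, ⁅x, y⁆ ∈ LieAlgebra.center ℝ g)
    (ha_comp : IsCompatibleWithGrading a k z c V) :
    (HasFlatGenericCoadjointOrbits g ↔
      (a.toSubmodule = (LieAlgebra.center ℝ g).toSubmodule ∨ IsHeisenbergAlgebra ℝ a)) ∧
    (HasFlatGenericCoadjointOrbits g →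
      ∃ p : LieIdeal ℝ g, Maximal (fun q : LieIdeal ℝ g => IsLieAbelian q) p ∧
        ∀ O : Set (Module.Dual ℝ g), IsGenericCoadjointOrbit O →
          ∀ ξ ∈ O, IsPolarization (p : LieSubalgebra ℝ g) ξ) := by
  obtain ⟨Z, H⟩ := exists_isAdaptedDecomposition hg hγ ha_lie ha_comp
  have hcenter : HasFlatGenericCoadjointOrbits g →
      ∀ b ∈ a, (∀ x ∈ a, ⁅b, x⁆ = 0) → b ∈ Submodule.span ℝ {Z} := by
    intro hflat b hb hba
    obtain ⟨τ, hτ⟩ := H.exists_dual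
    have hτ0 : τ Z ≠ 0 := by rw [hτ]; exact one_ne_zero
    exact H.mem_span_of_isFlat hτ0 (hflat _ (H.isGenericCoadjointOrbit hτ0)) hb hba
  refine ⟨⟨fun hflat => ?_, fun h => H.hasFlatGenericCoadjointOrbits fun b hb hba => ?_⟩,
    fun hflat => ?_⟩
  · rw [H.center_eq, or_iff_not_imp_left]
    exact H.isHeisenbergAlgebra (hcenter hflat)
  · rcases h with h | h
    · rwa [← H.center_eq, ← h]
    · exact H.mem_span_of_isHeisenbergAlgebra h hb hba
  · obtain ⟨p, hp, hpol⟩ := H.exists_ideal_isPolarization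
    refine ⟨p, hp, ?_⟩
    rintro O ⟨ξ₀, rfl, hgen⟩ ξ hξ
    rcases H.apply_ne_zero_or_lie_eq_zero (hcenter hflat) hgen with h | h0
    · exact hpol ξ (by rwa [H.apply_Z_of_mem_coadjointOrbit hξ])
    · -- The Lie algebra is abelian, so the maximal abelian ideal is everything.
      refine ⟨fun x _ y _ => by rw [h0, map_zero], fun W _ _ x _ => ?_⟩
      have htop : IsLieAbelian (⊤ : LieIdeal ℝ g) := ⟨fun x y => Subtype.ext (h0 x y)⟩
      exact hp.2 htop le_top (LieSubmodule.mem_top x)
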